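/- Let $p$ be an odd prime and let $G$ be a profinite group. Write $H^i(G)=H^i(G,\mathbb{Z}/p)$ for continuous cohomology with trivial action; thus $H^1(G)=\operatorname{Hom}_{\mathrm{cont}}(G,\mathbb{Z}/p)$. Let $\cup\colon H^1(G)\otimes_{\mathbb{Z}}H^1(G)\to H^2(G)$ be the homomorphism induced by the cup product, and let $\beta_G\colon H^1(G)\to H^2(G)$ be the Bockstein homomorphism, that is, the connecting homomorphism of $0\to\mathbb{Z}/p\to\mathbb{Z}/p^2\to\mathbb{Z}/p\to0$. Suppose that $G$ has Galois relation type (with respect to $p$), that is: (i) the kernel of $\cup\colon H^1(G)\otimes_{\mathbb{Z}}H^1(G)\to H^2(G)$ is generated, as a group, by the elements of the form $\psi\otimes\psi'$, with $\psi,\psi'\in H^1(G)$, that it contains; and (ii) there is $\xi\in H^1(G)$ such that $\psi\cup\xi+\beta_G(\psi)=0$ for every $\psi\in H^1(G)$. Define the descending $p$-central sequence of $G$ by $G^{(1)}=G$ and $G^{(i+1)}=(G^{(i)})^p[G^{(i)},G]$, the closed subgroup of $G$ generated by all $h^p$ and all $[h,g]=h^{-1}g^{-1}hg$ with $h\in G^{(i)}$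 and $g\in G$. Let $$M_{p^3}=\langle r,s\mid r^{p^2}=s^p=1,\ [r,s]=r^p\rangle$$ be the modular group of order $p^3$, i.e. the nonabelian group of order $p^3$ and exponent $p^2$. Then $G^{(3)}$ is the intersection of all open normal subgroups $N$ of $G$ such that $G/N$ is isomorphic to one of the groups $1$, $\mathbb{Z}/p^2$, $M_{p^3}$. -/

import Mathlib

open scoped TensorProduct

namespace ProfiniteCohomology

section Cochains

variable (G A : Type*) [Group G] [TopologicalSpace G] [IsTopologicalGroup G]
  [AddCommGroup A] [TopologicalSpace A] [IsTopologicalAddGroup A]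

/-- The coboundary `C¹(G, A) → C²(G, A)` on continuous inhomogeneous cochains, where `G` acts
trivially on `A`: `(df)(g, h) = f(h) - f(gh) + f(g)`. -/
def d₁ : C(G, A) →+ C(G × G, A) where
  toFun f := ⟨fun x => f x.2 - f (x.1 * x.2) + f x.1, by fun_prop⟩
  map_zero' := by ext x; simp
  map_add' f f' := by ext x; simp; abel

/-- The coboundary `C²(G, A) → C³(G, A)` on continuous inhomogeneous cochains, where `G` acts
trivially on `A`: `(df)(g, h, k) = f(h, k) - f(gh, k) + f(g, hk) - f(g, h)`. -/
def d₂ : C(G × G, A) →+ C(G × G × G, A) where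
  toFun f := ⟨fun x => f (x.2.1, x.2.2) - f (x.1 * x.2.1, x.2.2) + f (x.1, x.2.1 * x.2.2)
    - f (x.1, x.2.1), by fun_prop⟩
  map_zero' := by ext x; simp
  map_add' f f' := by ext x; simp; abel

/-- Continuous 2-cocycles. -/
def Z2 : AddSubgroup C(G × G, A) := (d₂ G A).ker

/-- Continuous 2-coboundaries. -/
def B2 : AddSubgroup C(G × G, A) := (d₁ G A).range

/-- `H²(G, A) = Z²(G, A) / B²(G, A)`. -/
abbrev H2 : Type _ := Z2 G A ⧸ (B2 G A).addSubgroupOf (Z2 G A)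

theorem B2_le_Z2 : B2 G A ≤ Z2 G A := by
  rintro _ ⟨f, rfl⟩
  ext x
  simp [d₁, d₂, mul_assoc]
  abel

/-- The cohomology class of a 2-cocycle. -/
def H2.mk : Z2 G A →+ H2 G A := QuotientAddGroup.mk' _

end Cochains

section H1

variable (G : Type*) [Group G] [TopologicalSpace G]

/-- `H¹(G, ℤ/q)`: the group of continuous homomorphisms `G → ℤ/q` (with `ℤ/q` discrete and with
trivial action). -/
abbrev H1 (q : ℕ) : Type _ := Additive G →ₜ+ ZMod q

variable {G} {q : ℕ}

/-- The value of `ψ ∈ H¹(G, ℤ/q)` at an element of `G`. -/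
def H1.eval (ψ : H1 G q) (g : G) : ZMod q := ψ (Additive.ofMul g)

theorem H1.continuous_eval (ψ : H1 G q) : Continuous ψ.eval :=
  ψ.continuous_toFun.comp continuous_ofMul

theorem H1.eval_mul (ψ : H1 G q) (g h : G) : ψ.eval (g * h) = ψ.eval g + ψ.eval h :=
  map_add ψ _ _

/-- The natural map `H¹(G, ℤ/q) → H¹(G, ℤ/m)` for `m ∣ q`, induced by the projection
`ℤ/q → ℤ/m`. -/
def H1.reduce {m : ℕ} (hm : m ∣ q) (ψ : H1 G q) : H1 G m :=
  ContinuousAddMonoidHom.comp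
    { toAddMonoidHom := (ZMod.castHom hm (ZMod m)).toAddMonoidHom
      continuous_toFun := continuous_of_discreteTopology } ψ

variable [IsTopologicalGroup G]

/-- The 2-cocycle `(g, h) ↦ ψ(g) ψ'(h)`. -/
def cupCocycle (ψ ψ' : H1 G q) : Z2 G (ZMod q) :=
  ⟨⟨fun x => ψ.eval x.1 * ψ'.eval x.2,
    (ψ.continuous_eval.comp continuous_fst).mul (ψ'.continuous_eval.comp continuous_snd)⟩, by
    ext x
    simp [d₂, H1.eval_mul]
    ring⟩

/-- The cup product `H¹(G, ℤ/q) × H¹(G, ℤ/q) → H²(G, ℤ/q)` as a `ℤ`-bilinear map. -/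
def cup : H1 G q →ₗ[ℤ] H1 G q →ₗ[ℤ] H2 G (ZMod q) :=
  (AddMonoidHom.mk' (fun ψ => (AddMonoidHom.mk'
      (fun ψ' => H2.mk G (ZMod q) (cupCocycle ψ ψ')) (fun a b => by
        rw [← map_add]; congr 1; ext x; exact mul_add _ _ _)).toIntLinearMap)
    (fun a b => by
      ext c
      change H2.mk G (ZMod q) _ = H2.mk G (ZMod q) _ + H2.mk G (ZMod q) _
      rw [← map_add]; congr 1; ext x; exact add_mul _ _ _)).toIntLinearMap

/-- The induced homomorphism `H¹(G, ℤ/q) ⊗ H¹(G, ℤ/q) → H²(G, ℤ/q)`. -/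
noncomputable def cupTensor : H1 G q ⊗[ℤ] H1 G q →ₗ[ℤ] H2 G (ZMod q) :=
  TensorProduct.lift cup

/-- The 2-cocycle `f` with `q f = dψ̃`, where `ψ̃ : G → ℤ/q²` is the lift of `ψ` with values
represented by integers in `[0, q)`. -/
def bocksteinCocycle [NeZero q] (ψ : H1 G q) : Z2 G (ZMod q) :=
  ⟨⟨fun x => (((ψ.eval x.1).val + (ψ.eval x.2).val) / q : ℕ),
    (continuous_of_discreteTopology
      (f := fun y : ZMod q × ZMod q => (((y.1.val + y.2.val) / q : ℕ) : ZMod q))).comp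
      ((ψ.continuous_eval.comp continuous_fst).prodMk
        (ψ.continuous_eval.comp continuous_snd))⟩, by
    ext x
    obtain ⟨g, h, k⟩ := x
    have key : ∀ a b : ZMod q, (q : ℤ) * ((a.val + b.val) / q : ℕ)
        = a.val + b.val - (a + b).val := by
      intro a b
      rw [ZMod.val_add]
      have := Nat.div_add_mod (a.val + b.val) q
      zify at this ⊢
      linarith
    set a := ψ.eval g
    set b := ψ.eval h
    set c := ψ.eval k
    have hz : (((b.val + c.val) / q : ℕ) : ℤ) - (((a + b).val + c.val) / q : ℕ)
        + ((a.val + (b + c).val) / q : ℕ) - ((a.val + b.val) / q : ℕ) = 0 := by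
      have hq : (q : ℤ) ≠ 0 := by exact_mod_cast NeZero.ne q
      apply mul_left_cancel₀ hq
      have h1 := key b c
      have h2 := key (a + b) c
      have h3 := key a (b + c)
      have h4 := key a b
      rw [add_assoc a b c] at h2
      linear_combination h1 - h2 + h3 - h4
    have := congrArg (Int.cast : ℤ → ZMod q) hz
    simp only [Int.cast_sub, Int.cast_add, Int.cast_natCast, Int.cast_zero] at this
    simp only [d₂, AddMonoidHom.coe_mk, ZeroHom.coe_mk, ContinuousMap.coe_mk, H1.eval_mul]
    exact this⟩

/-- The Bockstein map `β_G : H¹(G, ℤ/q) → H²(G, ℤ/q)`: the connecting map of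
`0 → ℤ/q → ℤ/q² → ℤ/q → 0`. See `bockstein_eq` for its independence of the chosen lift. -/
def bockstein [NeZero q] (ψ : H1 G q) : H2 G (ZMod q) :=
  H2.mk G (ZMod q) (bocksteinCocycle ψ)

/-- The Bockstein map is the connecting map: if `φ : G → ℤ/q²` is any continuous lift of `ψ` and
`f` is a 2-cocycle whose image under the injection `ℤ/q → ℤ/q²`, `i ↦ q i`, is `dφ`, then
`β_G(ψ)` is the class of `f`. -/
theorem bockstein_eq [NeZero q] (ψ : H1 G q) (φ : C(G, ZMod (q * q)))
    (hφ : ∀ g, (ZMod.castHom (dvd_mul_right q q) (ZMod q)) (φ g) = ψ.eval g)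
    (f : Z2 G (ZMod q))
    (hf : ∀ x : G × G, ((q * (f.1 x).val : ℕ) : ZMod (q * q)) = d₁ G (ZMod (q * q)) φ x) :
    bockstein ψ = H2.mk G (ZMod q) f := by
  have hq : (q : ℤ) ≠ 0 := by exact_mod_cast NeZero.ne q
  -- the difference of the two lifts, divided by `q`
  let e : ZMod (q * q) → ZMod q := fun y => ((y.val / q : ℕ) : ZMod q)
  let u : C(G, ZMod q) := ⟨fun g => e (φ g),
    (continuous_of_discreteTopology (f := e)).comp φ.continuous⟩
  have hval : ∀ g, ((φ g).val : ℤ) = q * ((φ g).val / q : ℕ) + (ψ.eval g).val := by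
    intro g
    have h1 : (ψ.eval g).val = (φ g).val % q := by
      rw [← hφ g, ZMod.castHom_apply, ZMod.cast_eq_val, ZMod.val_natCast]
    have h2 := Nat.div_add_mod (φ g).val q
    rw [h1]
    exact_mod_cast h2.symm
  refine (QuotientAddGroup.eq (s := (B2 G (ZMod q)).addSubgroupOf (Z2 G (ZMod q)))).2 ?_
  rw [AddSubgroup.mem_addSubgroupOf]
  refine ⟨u, ?_⟩
  ext ⟨g, h⟩
  have hx := hf (g, h)
  have hcarry : (q : ℤ) * (((ψ.eval g).val + (ψ.eval h).val) / q : ℕ)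
      = (ψ.eval g).val + (ψ.eval h).val - (ψ.eval (g * h)).val := by
    rw [ψ.eval_mul, ZMod.val_add]
    have := Nat.div_add_mod ((ψ.eval g).val + (ψ.eval h).val) q
    zify at this ⊢
    linarith
  have hx' : (((q * (f.1 (g, h)).val : ℤ)) : ZMod (q * q))
      = (((φ h).val - (φ (g * h)).val + (φ g).val : ℤ) : ZMod (q * q)) := by
    push_cast
    rw [ZMod.natCast_zmod_val, ZMod.natCast_zmod_val, ZMod.natCast_zmod_val]
    simpa [d₁] using hx
  rw [ZMod.intCast_eq_intCast_iff_dvd_sub] at hx'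
  rw [hval, hval, hval] at hx'
  have h5 : ((q : ℤ) * q) ∣ q * ((((φ h).val / q : ℕ) : ℤ) - ((φ (g * h)).val / q : ℕ)
      + ((φ g).val / q : ℕ) + (((ψ.eval g).val + (ψ.eval h).val) / q : ℕ)
      - (f.1 (g, h)).val) := by
    push_cast at hx' hcarry ⊢
    convert hx' using 1
    linear_combination hcarry
  have h6 := (ZMod.intCast_zmod_eq_zero_iff_dvd _ q).2 (Int.dvd_of_mul_dvd_mul_left hq h5)
  simp only [Int.cast_sub, Int.cast_add, Int.cast_natCast, ZMod.natCast_zmod_val] at h6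
  change e (φ h) - e (φ (g * h)) + e (φ g) = -(_ : ZMod q) + f.1 (g, h)
  simp only [e, bocksteinCocycle, ContinuousMap.coe_mk]
  linear_combination h6

end H1

/-- `G` has Galois relation type with respect to the prime power `q`. The divisors of `q = p ^ d`
are the `p ^ i` with `0 ≤ i ≤ d`, and `reduce_surjective` is void for the divisor `1`. -/
structure HasGaloisRelationType (q : ℕ) [NeZero q] (G : Type*) [Group G] [TopologicalSpace G]
    [IsTopologicalGroup G] : Prop where
  /-- The kernel of the cup product on `H¹ ⊗ H¹` is generated by pure tensors. -/
  ker_cup : (cupTensor (G := G) (q := q)).toAddMonoidHom.ker =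
    AddSubgroup.closure {t | cupTensor t = 0 ∧ ∃ ψ ψ' : H1 G q, t = ψ ⊗ₜ[ℤ] ψ'}
  /-- Some `ξ ∈ H¹(G)` satisfies `ψ ∪ ξ + β_G(ψ) = 0` for every `ψ ∈ H¹(G)`. -/
  bockstein_eq_cup : ∃ ξ : H1 G q, ∀ ψ : H1 G q, cup ψ ξ + bockstein ψ = 0
  /-- `H¹(G, ℤ/q) → H¹(G, ℤ/m)` is surjective for every divisor `m` of `q`. -/
  reduce_surjective : ∀ (m : ℕ) (hm : m ∣ q), Function.Surjective (H1.reduce (G := G) hm)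

end ProfiniteCohomology

/-- The descending `q`-central sequence of `G`, indexed from `1`: `G⁽¹⁾ = G`, and `G⁽ⁱ⁺¹⁾` is the
closed subgroup generated by all powers `h ^ q` and all commutators `h⁻¹ g⁻¹ h g`, where `h ∈ G⁽ⁱ⁾`
and `g ∈ G`. (The value at the unused index `0` is `G`.) -/
def descendingQCentral (q : ℕ) (G : Type*) [Group G] [TopologicalSpace G]
    [IsTopologicalGroup G] : ℕ → Subgroup G
  | 0 => ⊤
  | 1 => ⊤
  | i + 2 => (Subgroup.closure
      ({x | ∃ h ∈ descendingQCentral q G (i + 1), x = h ^ q} ∪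
        {x | ∃ h ∈ descendingQCentral q G (i + 1), ∃ g : G,
          x = h⁻¹ * g⁻¹ * h * g})).topologicalClosure

/-- The relators of the modular group; `r` and `s` are the generators `of 0` and `of 1`. -/
def modularGroupRels (p : ℕ) : Set (FreeGroup (Fin 2)) :=
  let r : FreeGroup (Fin 2) := FreeGroup.of 0
  let s : FreeGroup (Fin 2) := FreeGroup.of 1
  {r ^ (p ^ 2), s ^ p, (r⁻¹ * s⁻¹ * r * s) * (r ^ p)⁻¹}

/-- The modular group `M_{p³} = ⟨r, s ∣ r ^ (p²) = s ^ p = 1, [r, s] = r ^ p⟩`, where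
`[r, s] = r⁻¹ s⁻¹ r s`. -/
abbrev ModularGroupP3 (p : ℕ) : Type := PresentedGroup (modularGroupRels p)

/-! A cochain `h : G → ℤ/p` whose coboundary is the standard cocycle of `χ ∪ η + β(χ)` is the same
thing as a lift of `(χ, η) : G → (ℤ/p)²` to a homomorphism into `M_{p³}`. If `χ ≠ 0` and `η` is not
a multiple of `χ`, the lift is onto `M_{p³}`; if `η = aχ`, then, `p` being odd, `χ ∪ η` is a
coboundary and a correction of `h` gives a map onto `ℤ/p²`. In both cases `χ` and `h` vanish on the
kernel (`exists_normal_of_coboundary`).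

Let `g` lie in every `N` of the list. Condition (ii) provides such an `h` for every `χ`, with `η =
ξ`, so `H¹(G)` kills `g`. Hence the value of a cochain at `g` depends only on its coboundary.
Suppose `g ∉ G⁽³⁾`. Some finite quotient by an open `N ⊇ G⁽³⁾` has a central subgroup of exponent
`p` in which `g` is nontrivial. A character of that subgroup, nonzero at `g`, extends up to sign to
a cochain `f` with `f g ≠ 0` whose coboundary is a sum of cup products and one Bockstein cocycle
(`exists_coboundary_eq_sum_mul_add_carry`, `exists_coboundary_of_notMem`). Subtracting the
trivialization of `ψ ∪ ξ + β(ψ)` leaves a tensor in the kernel of the cup product, which by (i) is a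
combination of pure tensors in that kernel. If `ψ ∪ ψ' = 0`, then `ψ ∪ (ψ' + ξ) + β(ψ) = 0`, so the
corresponding trivialization vanishes at `g`. Adding up gives `f g = 0`, a contradiction.

Conversely, the three groups embed in `M_{p³}`, where the third term of the sequence is trivial. -/

/-! ### Arithmetic of `ℤ/p²` and the carry cocycle -/

/-- The injection `ℤ/p → ℤ/p²`, `t ↦ p t`. -/
def pMul (p : ℕ) : ZMod p →+ ZMod (p ^ 2) :=
  ZMod.lift p ⟨(AddMonoidHom.mulLeft (p : ZMod (p ^ 2))).comp (Int.castAddHom _), by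
    simp only [AddMonoidHom.coe_comp, Function.comp_apply, Int.coe_castAddHom,
      AddMonoidHom.coe_mulLeft, Int.cast_natCast]
    rw [← sq, ← Nat.cast_pow, ZMod.natCast_self]⟩

theorem pMul_intCast (p : ℕ) (n : ℤ) : pMul p (n : ZMod p) = p * (n : ZMod (p ^ 2)) := by
  simp [pMul]

theorem pMul_natCast (p : ℕ) (n : ℕ) : pMul p (n : ZMod p) = p * (n : ZMod (p ^ 2)) := by
  exact_mod_cast pMul_intCast p n

theorem pMul_one (p : ℕ) : pMul p 1 = p := by
  simpa using pMul_natCast p 1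

theorem pMul_injective (p : ℕ) [NeZero p] : Function.Injective (pMul p) := by
  rw [injective_iff_map_eq_zero]
  intro a ha
  obtain ⟨n, rfl⟩ := ZMod.natCast_zmod_surjective a
  rw [pMul_natCast, ← Nat.cast_mul, ZMod.natCast_eq_zero_iff, sq] at ha
  rw [ZMod.natCast_eq_zero_iff]
  exact Nat.dvd_of_mul_dvd_mul_left (Nat.pos_of_ne_zero (NeZero.ne p)) ha

/-- The projection `ℤ/p² → ℤ/p`. -/
def modP (p : ℕ) : ZMod (p ^ 2) →+* ZMod p := ZMod.castHom (dvd_pow_self p two_ne_zero) (ZMod p)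

theorem modP_pMul (p : ℕ) [NeZero p] (a : ZMod p) : modP p (pMul p a) = 0 := by
  obtain ⟨n, rfl⟩ := ZMod.natCast_zmod_surjective a
  rw [pMul_natCast]
  simp

theorem exists_pMul_of_modP_eq_zero (p : ℕ) [NeZero p] (a : ZMod (p ^ 2)) (ha : modP p a = 0) :
    ∃ t, pMul p t = a := by
  obtain ⟨n, rfl⟩ := ZMod.natCast_zmod_surjective a
  rw [map_natCast, ZMod.natCast_eq_zero_iff] at ha
  obtain ⟨k, rfl⟩ := ha
  exact ⟨k, by rw [pMul_natCast]; push_cast; rfl⟩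

theorem mul_pMul (p : ℕ) [NeZero p] (a : ZMod (p ^ 2)) (t : ZMod p) :
    a * pMul p t = pMul p (modP p a * t) := by
  obtain ⟨n, rfl⟩ := ZMod.natCast_zmod_surjective a
  obtain ⟨m, rfl⟩ := ZMod.natCast_zmod_surjective t
  rw [map_natCast (modP p), ← Nat.cast_mul, pMul_natCast, pMul_natCast]
  push_cast
  ring

/-- The carry of the addition of two residues in `[0, p)`. -/
def carry (p : ℕ) (a b : ZMod p) : ZMod p := ((a.val + b.val) / p : ℕ)

/-- The lift `ℤ/p → ℤ/p²` with values represented by integers in `[0, p)`. -/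
def liftSq {p : ℕ} (a : ZMod p) : ZMod (p ^ 2) := (a.val : ZMod (p ^ 2))

theorem modP_liftSq {p : ℕ} [NeZero p] (a : ZMod p) : modP p (liftSq a) = a := by
  simp [liftSq]

theorem pMul_carry {p : ℕ} [NeZero p] (a b : ZMod p) :
    pMul p (carry p a b) = liftSq a + liftSq b - liftSq (a + b) := by
  rw [carry, pMul_natCast, liftSq, liftSq, liftSq, ZMod.val_add, eq_sub_iff_add_eq]
  exact_mod_cast congrArg (Nat.cast (R := ZMod (p ^ 2))) (Nat.div_add_mod (a.val + b.val) p)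

theorem carry_cocycle {p : ℕ} [NeZero p] (a b c : ZMod p) :
    carry p b c - carry p (a + b) c + carry p a (b + c) - carry p a b = 0 := by
  apply pMul_injective p
  simp only [map_sub, map_add, map_zero, pMul_carry, add_assoc]
  abel

theorem carry_comm {p : ℕ} (a b : ZMod p) : carry p a b = carry p b a := by
  rw [carry, carry, add_comm]

theorem carry_zero_left {p : ℕ} [NeZero p] (a : ZMod p) : carry p 0 a = 0 := by
  rw [carry, ZMod.val_zero, zero_add, Nat.div_eq_of_lt a.val_lt, Nat.cast_zero]

/-- After multiplication by `p` the sum telescopes to `p • liftSq a`. This is why a Bockstein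
cocycle records `p`-th powers in a central extension. -/
theorem sum_carry {p : ℕ} [NeZero p] (a : ZMod p) :
    ∑ k ∈ Finset.range p, carry p (k • a) a = a := by
  apply pMul_injective p
  rw [map_sum]
  simp only [pMul_carry]
  have h : ∀ n : ℕ, ∑ k ∈ Finset.range n, (liftSq (k • a) + liftSq a - liftSq (k • a + a))
      = n • liftSq a - liftSq (n • a) := by
    intro n
    induction n with
    | zero => simp [liftSq]
    | succ n ih => rw [Finset.sum_range_succ, ih, succ_nsmul, succ_nsmul]; abel
  rw [h]
  have : p • a = 0 := by simp
  rw [this]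
  conv_rhs => rw [← ZMod.natCast_zmod_val a, pMul_natCast]
  simp [liftSq]

/-! ### Characters of elementary abelian quotients -/

theorem exists_linearMap_ne_zero {k V : Type*} [Field k] [AddCommGroup V] [Module k V] (x : V)
    (hx : x ≠ 0) : ∃ F : V →ₗ[k] k, F x ≠ 0 := by
  by_contra! h
  exact hx ((Module.forall_dual_apply_eq_zero_iff k x).1 h)

theorem exists_addMonoidHom_ne_zero (p : ℕ) [Fact p.Prime] {V : Type*} [AddCommGroup V]
    (hV : ∀ v : V, p • v = 0) (x : V) (hx : x ≠ 0) : ∃ F : V →+ ZMod p, F x ≠ 0 := by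
  let _ : Module (ZMod p) V := AddCommGroup.zmodModule hV
  obtain ⟨F, hF⟩ := exists_linearMap_ne_zero (k := ZMod p) x hx
  exact ⟨F.toAddMonoidHom, hF⟩

/-- Characters of exponent `p` separate the points of an elementary abelian quotient. -/
theorem exists_character_ne_zero (p : ℕ) [Fact p.Prime] {A : Type*} [Group A] (K : Subgroup A)
    [K.Normal] (hpow : ∀ a : A, a ^ p ∈ K) (hcomm : ∀ a b : A, ∃ k ∈ K, a * b = k * (b * a))
    (x : A) (hx : x ∉ K) :
    ∃ χ : Additive A →+ ZMod p, (∀ k ∈ K, χ (Additive.ofMul k) = 0) ∧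
      χ (Additive.ofMul x) ≠ 0 := by
  let : CommGroup (A ⧸ K) :=
    { (inferInstance : Group (A ⧸ K)) with
      mul_comm := by
        intro a b
        obtain ⟨a, rfl⟩ := QuotientGroup.mk_surjective a
        obtain ⟨b, rfl⟩ := QuotientGroup.mk_surjective b
        obtain ⟨k, hk, h⟩ := hcomm a b
        rw [← QuotientGroup.mk_mul, h, QuotientGroup.mk_mul, (QuotientGroup.eq_one_iff k).2 hk,
          one_mul, QuotientGroup.mk_mul] }
  obtain ⟨F, hF⟩ := exists_addMonoidHom_ne_zero p (V := Additive (A ⧸ K)) (by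
    intro a
    obtain ⟨a, rfl⟩ := QuotientGroup.mk_surjective a.toMul
    change Additive.ofMul ((a : A ⧸ K) ^ p) = 0
    rw [← QuotientGroup.mk_pow, (QuotientGroup.eq_one_iff _).2 (hpow a), ofMul_one])
    (Additive.ofMul (x : A ⧸ K)) (fun h => hx ((QuotientGroup.eq_one_iff x).1 h))
  refine ⟨F.comp (QuotientGroup.mk' K).toAdditive, ?_, hF⟩
  intro k hk
  change F (Additive.ofMul (k : A ⧸ K)) = 0
  rw [(QuotientGroup.eq_one_iff k).2 hk, ofMul_one, map_zero]

/-- A biadditive map on a finite group is a sum of products of characters. -/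
theorem exists_eq_sum_mul_of_biadditive (p : ℕ) [Fact p.Prime] {E : Type*} [Group E] [Finite E]
    (b : Additive E →+ Additive E →+ ZMod p) :
    ∃ (n : ℕ) (ψ ψ' : Fin n → Additive E →+ ZMod p), ∀ x y, b x y = ∑ i, ψ i x * ψ' i y := by
  have : Finite (Additive E →+ ZMod p) := DFunLike.finite _
  have : Finite (Additive E) := inferInstanceAs (Finite E)
  let B := Module.finBasis (ZMod p) (Additive E →+ ZMod p)
  refine ⟨_, fun i => (B.coord i).toAddMonoidHom.comp b, fun i => B i, fun x y => ?_⟩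
  conv_lhs => rw [← B.sum_repr (b x)]
  rw [AddMonoidHom.finsetSum_apply]
  rfl

/-! ### Central extensions by `ℤ/p` and their cocycles -/

/-- The set underlying the central extension of `E` by `ℤ/p` with cocycle `-c`. -/
@[ext]
structure TwistedProduct {E : Type*} {p : ℕ} (c : E → E → ZMod p) where
  /-- The component in the quotient. -/
  fst : E
  /-- The component in the kernel. -/
  snd : ZMod p

namespace TwistedProduct

variable {E : Type*} {p : ℕ} {c : E → E → ZMod p}

variable [Group E]

instance : Mul (TwistedProduct c) := ⟨fun a b => ⟨a.1 * b.1, a.2 + b.2 - c a.1 b.1⟩⟩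

instance : One (TwistedProduct c) := ⟨⟨1, 0⟩⟩

instance : Inv (TwistedProduct c) := ⟨fun a => ⟨a.1⁻¹, -a.2 + c a.1⁻¹ a.1⟩⟩

@[simp] theorem fst_mul (a b : TwistedProduct c) : (a * b).1 = a.1 * b.1 := rfl
@[simp] theorem snd_mul (a b : TwistedProduct c) : (a * b).2 = a.2 + b.2 - c a.1 b.1 := rfl
@[simp] theorem fst_one : (1 : TwistedProduct c).1 = 1 := rfl
@[simp] theorem snd_one : (1 : TwistedProduct c).2 = 0 := rfl
@[simp] theorem fst_inv (a : TwistedProduct c) : (a⁻¹).1 = a.1⁻¹ := rfl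
@[simp] theorem snd_inv (a : TwistedProduct c) : (a⁻¹).2 = -a.2 + c a.1⁻¹ a.1 := rfl

/-- The group structure given by a normalized cocycle. -/
@[reducible] def group (h₁ : ∀ x, c 1 x = 0)
    (hc : ∀ x y z, c y z - c (x * y) z + c x (y * z) - c x y = 0) : Group (TwistedProduct c) :=
  Group.ofLeftAxioms
    (fun x y z => by
      ext
      · simp [mul_assoc]
      · have := hc x.1 y.1 z.1
        simp only [snd_mul, fst_mul]
        linear_combination this)
    (fun x => by ext <;> simp [h₁])
    (fun x => by ext <;> simp)

end TwistedProduct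

section ClassTwo

open scoped commutatorElement

variable {E : Type*} [Group E]

theorem pow_mul_eq_of_mul_eq {x y c : E} (hcy : Commute c y)
    (h : y * x = c * (x * y)) (n : ℕ) : y ^ n * x = c ^ n * (x * y ^ n) := by
  induction n with
  | zero => simp
  | succ n ih =>
    rw [pow_succ y, mul_assoc, h, ← mul_assoc, ← (hcy.pow_right n).eq, mul_assoc, ← mul_assoc _ x,
      ih, pow_succ' c]
    simp only [mul_assoc]

/-- Moving each `x` past the powers of `y` costs `1 + 2 + ⋯ + (n - 1)` copies of the central element
`c`. -/
theorem mul_pow_of_mul_eq {x y c : E} (hcx : Commute c x) (hcy : Commute c y)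
    (h : y * x = c * (x * y)) (n : ℕ) : (x * y) ^ n = c ^ n.choose 2 * (x ^ n * y ^ n) := by
  induction n with
  | zero => simp
  | succ n ih =>
    rw [pow_succ, ih, Nat.choose_succ_succ' n 1, Nat.choose_one_right, add_comm, pow_add]
    have h1 := pow_mul_eq_of_mul_eq hcy h n
    calc c ^ n.choose 2 * (x ^ n * y ^ n) * (x * y)
        = c ^ n.choose 2 * (x ^ n * (y ^ n * x) * y) := by simp only [mul_assoc]
      _ = c ^ n.choose 2 * (x ^ n * c ^ n * (x * y ^ n) * y) := by rw [h1]; simp only [mul_assoc]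
      _ = c ^ n.choose 2 * (c ^ n * x ^ n * (x * y ^ n) * y) := by
          rw [((hcx.pow_left n).pow_right n).eq]
      _ = _ := by simp only [pow_succ, mul_assoc]

theorem commutator_mul_left_of_central {Z : Subgroup E} (hZ : ∀ z ∈ Z, ∀ x, z * x = x * z)
    (hcomm : ∀ x y : E, ⁅x, y⁆ ∈ Z) (x y z : E) : ⁅x * y, z⁆ = ⁅x, z⁆ * ⁅y, z⁆ := by
  have h : ⁅x * y, z⁆ = x * ⁅y, z⁆ * x⁻¹ * ⁅x, z⁆ := by
    simp only [commutatorElement_def]; group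
  rw [h, ← hZ _ (hcomm y z) x, mul_inv_cancel_right, hZ _ (hcomm y z)]

theorem commutator_mul_right_of_central {Z : Subgroup E} (hZ : ∀ z ∈ Z, ∀ x, z * x = x * z)
    (hcomm : ∀ x y : E, ⁅x, y⁆ ∈ Z) (x y z : E) : ⁅x, y * z⁆ = ⁅x, y⁆ * ⁅x, z⁆ := by
  have h : ⁅x, y * z⁆ = ⁅x, y⁆ * (y * ⁅x, z⁆ * y⁻¹) := by
    simp only [commutatorElement_def]; group
  rw [h, ← hZ _ (hcomm x z) y, mul_inv_cancel_right]

variable {p : ℕ} [Fact p.Prime] {Z : Subgroup E} {L : E → ZMod p}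

theorem map_pow_of_map_mul (hL : ∀ z ∈ Z, ∀ w ∈ Z, L (z * w) = L z + L w) {z : E} (hz : z ∈ Z)
    (n : ℕ) : L (z ^ n) = n * L z := by
  have h1 : L 1 = 0 := by simpa using hL 1 Z.one_mem 1 Z.one_mem
  induction n with
  | zero => simp [h1]
  | succ n ih => rw [pow_succ, hL _ (pow_mem hz n) _ hz, ih]; push_cast; ring

/-- Half of the commutator pairing. -/
def commutatorPairing (hZ : ∀ z ∈ Z, ∀ x, z * x = x * z) (hcomm : ∀ x y : E, ⁅x, y⁆ ∈ Z)
    (hL : ∀ z ∈ Z, ∀ w ∈ Z, L (z * w) = L z + L w) : Additive E →+ Additive E →+ ZMod p :=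
  AddMonoidHom.mk' (fun x => AddMonoidHom.mk' (fun y => L ⁅x.toMul, y.toMul⁆ / 2) (fun y z => by
      rw [toMul_add, commutator_mul_right_of_central hZ hcomm, hL _ (hcomm _ _) _ (hcomm _ _),
        add_div]))
    (fun x y => by
      ext z
      change L ⁅x.toMul * y.toMul, z⁆ / 2 = L ⁅x.toMul, z⁆ / 2 + L ⁅y.toMul, z⁆ / 2
      rw [commutator_mul_left_of_central hZ hcomm, hL _ (hcomm _ _) _ (hcomm _ _), add_div])

/-- The `p`-th power map followed by `L`. -/
def powCharacter (hp : p ≠ 2) (hZ : ∀ z ∈ Z, ∀ x, z * x = x * z) (hcomm : ∀ x y : E, ⁅x, y⁆ ∈ Z)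
    (hpow : ∀ x : E, x ^ p ∈ Z)
    (hL : ∀ z ∈ Z, ∀ w ∈ Z, L (z * w) = L z + L w) : Additive E →+ ZMod p :=
  AddMonoidHom.mk' (fun x => L (x.toMul ^ p)) (fun x y => by
    have h := mul_pow_of_mul_eq (x := x.toMul) (y := y.toMul) (c := ⁅y.toMul, x.toMul⁆)
      (hZ _ (hcomm _ _) _) (hZ _ (hcomm _ _) _) (by simp only [commutatorElement_def]; group) p
    -- Oddness of `p` makes the commutator term of the power formula disappear under `L`.
    have hd : p ∣ p.choose 2 := Nat.Prime.dvd_choose_self Fact.out two_ne_zero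
      (lt_of_le_of_ne (Nat.Prime.two_le Fact.out) hp.symm)
    rw [toMul_add, h, hL _ (pow_mem (hcomm _ _) _) _ (mul_mem (hpow _) (hpow _)),
      map_pow_of_map_mul hL (hcomm _ _), (ZMod.natCast_eq_zero_iff _ _).2 hd, zero_mul, zero_add,
      hL _ (hpow _) _ (hpow _)])

/-- For `p` odd, the class of a central extension of an elementary abelian group is a sum of cup
products and of a Bockstein element. -/
theorem exists_coboundary_eq_sum_mul_add_carry [Finite E] (hp : p ≠ 2)
    (hZ : ∀ z ∈ Z, ∀ x, z * x = x * z) (hcomm : ∀ x y : E, ⁅x, y⁆ ∈ Z)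
    (hpow : ∀ x : E, x ^ p ∈ Z) (hL : ∀ z ∈ Z, ∀ w ∈ Z, L (z * w) = L z + L w)
    (hLpow : ∀ z ∈ Z, z ^ p = 1) :
    ∃ (f : E → ZMod p) (P : Additive E →+ ZMod p) (n : ℕ) (ψ ψ' : Fin n → Additive E →+ ZMod p),
      (∀ z ∈ Z, f z = - L z) ∧
      ∀ x y : E, f y - f (x * y) + f x = ∑ i, ψ i (.ofMul x) * ψ' i (.ofMul y) +
        carry p (P (.ofMul x)) (P (.ofMul y)) := by
  have h2 : (2 : ZMod p) ≠ 0 := by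
    intro h
    have := (ZMod.natCast_eq_zero_iff 2 p).1 (by exact_mod_cast h)
    exact hp ((Nat.prime_dvd_prime_iff_eq Fact.out Nat.prime_two).1 this)
  have hL1 : L 1 = 0 := by simpa using hL 1 Z.one_mem 1 Z.one_mem
  have hLinv : ∀ z ∈ Z, L z⁻¹ = - L z := by
    intro z hz
    have := hL z hz _ (inv_mem hz)
    rw [mul_inv_cancel, hL1] at this
    linear_combination -this
  let b := commutatorPairing hZ hcomm hL
  let P := powCharacter hp hZ hcomm hpow hL
  have hb : ∀ x y : E, b (.ofMul x) (.ofMul y) = L ⁅x, y⁆ / 2 := fun _ _ => rfl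
  have hP : ∀ x : E, P (.ofMul x) = L (x ^ p) := fun _ => rfl
  obtain ⟨n, ψ, ψ', hψ⟩ := exists_eq_sum_mul_of_biadditive p b
  -- The cocycle is chosen to match `L` on both kinds of generators: its antisymmetrization gives
  -- `L` of commutators (hence the factor `1/2`), and its sum over the powers of `x` gives `L (x ^
  -- p)`.
  let c : E → E → ZMod p := fun x y => b (.ofMul x) (.ofMul y) + carry p (P (.ofMul x)) (P (.ofMul y))
  have hcZ : ∀ z ∈ Z, ∀ x, c z x = 0 := by
    intro z hz x
    have hzx : ⁅z, x⁆ = 1 := commutatorElement_eq_one_iff_mul_comm.2 (hZ z hz x)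
    simp only [c, hb, hP, hzx, hLpow z hz, hL1, carry_zero_left, zero_div, add_zero]
  have hcocycle : ∀ x y z, c y z - c (x * y) z + c x (y * z) - c x y = 0 := by
    intro x y z
    simp only [c, ofMul_mul, map_add, AddMonoidHom.add_apply]
    linear_combination carry_cocycle (P (.ofMul x)) (P (.ofMul y)) (P (.ofMul z))
  have hswap : ∀ x y, c x y - c y x = L ⁅x, y⁆ := by
    intro x y
    simp only [c, hb, carry_comm (P (.ofMul y))]
    rw [← commutatorElement_inv x y, hLinv _ (hcomm _ _)]
    field_simp
    ring
  let _ : Group (TwistedProduct c) := TwistedProduct.group (fun x => hcZ 1 Z.one_mem x) hcocycle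
  have hpowT : ∀ (a : TwistedProduct c) (m : ℕ), (a ^ m).fst = a.fst ^ m ∧
      (a ^ m).snd = m * a.snd - ∑ k ∈ Finset.range m, c (a.fst ^ k) a.fst := by
    intro a m
    induction m with
    | zero => exact ⟨by simp, by simp⟩
    | succ m ih =>
      rw [pow_succ]
      refine ⟨by rw [TwistedProduct.fst_mul, ih.1, pow_succ], ?_⟩
      rw [TwistedProduct.snd_mul, ih.1, ih.2, Finset.sum_range_succ]
      push_cast
      ring
  have hpowp : ∀ a : TwistedProduct c, (a ^ p).snd = - L (a.fst ^ p) := by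
    intro a
    rw [(hpowT a p).2, ← hP, ← sum_carry (P (.ofMul a.fst)), CharP.cast_eq_zero, zero_mul, zero_sub]
    congr 1
    refine Finset.sum_congr rfl fun k _ => ?_
    have hk : ⁅a.fst ^ k, a.fst⁆ = 1 :=
      commutatorElement_eq_one_iff_mul_comm.2 (pow_mul_comm' a.fst k)
    simp only [c, hb, hk, hL1, zero_div, zero_add, ofMul_pow, map_nsmul]
  -- The graph of `-L` over `Z` contains all commutators and `p`-th powers of the twisted product
  -- but not `(1, 1)`. A character trivial on it and nonzero at `(1, 1)` splits the extension.
  let K : Subgroup (TwistedProduct c) :=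
    { carrier := {a | a.fst ∈ Z ∧ a.snd = - L a.fst}
      one_mem' := ⟨Z.one_mem, by change (0 : ZMod p) = - L 1; rw [hL1, neg_zero]⟩
      mul_mem' := by
        rintro a b ⟨ha, ha'⟩ ⟨hb, hb'⟩
        refine ⟨mul_mem ha hb, ?_⟩
        rw [TwistedProduct.snd_mul, TwistedProduct.fst_mul, ha', hb', hL _ ha _ hb, hcZ _ ha]
        ring
      inv_mem' := by
        rintro a ⟨ha, ha'⟩
        refine ⟨inv_mem ha, ?_⟩
        change -a.snd + c a.fst⁻¹ a.fst = - L a.fst⁻¹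
        rw [ha', hcZ _ (inv_mem ha), hLinv _ ha]
        ring }
  have hK : ∀ a : TwistedProduct c, a ∈ K ↔ a.fst ∈ Z ∧ a.snd = - L a.fst := fun _ => Iff.rfl
  have hcommK : ∀ a b : TwistedProduct c, ∃ k ∈ K, a * b = k * (b * a) := by
    intro a b
    refine ⟨⟨⁅a.fst, b.fst⁆, -L ⁅a.fst, b.fst⁆⟩, ⟨hcomm _ _, rfl⟩, ?_⟩
    ext
    · simp only [TwistedProduct.fst_mul, commutatorElement_def]; group
    · simp only [TwistedProduct.snd_mul, hcZ _ (hcomm _ _)]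
      linear_combination -hswap a.fst b.fst
  have : K.Normal := by
    refine ⟨fun k hk a => ?_⟩
    obtain ⟨k', hk', h⟩ := hcommK a k
    rw [h, mul_assoc, mul_inv_cancel_right]
    exact mul_mem hk' hk
  obtain ⟨F, hFK, hF⟩ := exists_character_ne_zero p K
    (fun a => (hK _).2 ⟨by rw [(hpowT a p).1]; exact hpow _, by rw [hpowp, (hpowT a p).1]⟩)
    hcommK (⟨1, 1⟩ : TwistedProduct c) (fun h => by simpa [hL1] using ((hK _).1 h).2)
  have hF1 : ∀ t : ZMod p, F (.ofMul ⟨1, t⟩) = t * F (.ofMul ⟨1, 1⟩) := by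
    intro t
    obtain ⟨m, rfl⟩ := ZMod.natCast_zmod_surjective t
    rw [← nsmul_eq_mul, ← map_nsmul, ← ofMul_pow]
    congr 2
    ext
    · rw [(hpowT _ _).1]; simp
    · rw [(hpowT _ _).2]
      simp [hcZ 1 Z.one_mem]
  have hFt : ∀ (x : E) (t : ZMod p),
      F (.ofMul ⟨x, t⟩) = t * F (.ofMul ⟨1, 1⟩) + F (.ofMul ⟨x, 0⟩) := by
    intro x t
    rw [← hF1, ← map_add, ← ofMul_mul]
    congr 2
    ext
    · simp
    · simp [hcZ 1 Z.one_mem]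
  -- Dividing by `F (1, 1)` normalizes the character to be the identity on the kernel `ℤ/p`;
  -- triviality on `K` then forces the values on `Z`.
  refine ⟨fun x => -F (.ofMul ⟨x, 0⟩) / F (.ofMul ⟨1, 1⟩), P, n, ψ, ψ', ?_, ?_⟩
  · intro z hz
    have h := hFK ⟨z, -L z⟩ ⟨hz, rfl⟩
    rw [hFt] at h
    rw [div_eq_iff hF]
    linear_combination -h
  · intro x y
    rw [← hψ]
    change _ = c x y
    have h : F (.ofMul ⟨x, 0⟩) + F (.ofMul ⟨y, 0⟩) = F (.ofMul ⟨x * y, -c x y⟩) := by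
      rw [← map_add, ← ofMul_mul]
      congr 2
      ext
      · rfl
      · simp
    rw [hFt (x * y) (-c x y)] at h
    field_simp
    linear_combination -h

end ClassTwo

/-! ### The modular group of order `p³` -/

/-- The group of pairs `(a, b)` with the product `(a, b)(a', b') = (a + a' + p a b', b + b')`, a
concrete form of the modular group of order `p³`. -/
@[ext]
structure ModularPair (p : ℕ) where
  /-- The component in `ℤ/p²`. -/
  fst : ZMod (p ^ 2)
  /-- The component in `ℤ/p`. -/
  snd : ZMod p

namespace ModularPair

variable {p : ℕ}

instance : Mul (ModularPair p) := ⟨fun a b => ⟨a.1 + b.1 + pMul p (modP p a.1 * b.2), a.2 + b.2⟩⟩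

instance : One (ModularPair p) := ⟨⟨0, 0⟩⟩

instance : Inv (ModularPair p) := ⟨fun a => ⟨-a.1 + pMul p (modP p a.1 * a.2), -a.2⟩⟩

@[simp] theorem fst_mul (a b : ModularPair p) :
    (a * b).1 = a.1 + b.1 + pMul p (modP p a.1 * b.2) := rfl
@[simp] theorem snd_mul (a b : ModularPair p) : (a * b).2 = a.2 + b.2 := rfl
@[simp] theorem fst_one : (1 : ModularPair p).1 = 0 := rfl
@[simp] theorem snd_one : (1 : ModularPair p).2 = 0 := rfl
@[simp] theorem fst_inv (a : ModularPair p) : (a⁻¹).1 = -a.1 + pMul p (modP p a.1 * a.2) := rfl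
@[simp] theorem snd_inv (a : ModularPair p) : (a⁻¹).2 = -a.2 := rfl

theorem mk_eq (a : ZMod (p ^ 2)) (b : ZMod p) :
    (⟨0, b⟩ * ⟨a, 0⟩ : ModularPair p) = ⟨a, b⟩ := by
  ext <;> simp

instance [NeZero p] : Group (ModularPair p) :=
  Group.ofLeftAxioms
    (fun x y z => by
      ext
      · simp only [fst_mul, snd_mul, map_add, modP_pMul, add_zero, add_mul, mul_add]
        abel
      · simp [add_assoc])
    (fun x => by ext <;> simp)
    (fun x => by
      ext
      · simp only [fst_mul, fst_inv, map_add, map_neg, modP_pMul, add_zero, neg_mul, fst_one]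
        abel
      · simp)

variable [NeZero p]

theorem mk_zero_pow (a : ZMod (p ^ 2)) (n : ℕ) :
    (⟨a, 0⟩ : ModularPair p) ^ n = ⟨n * a, 0⟩ := by
  induction n with
  | zero => ext <;> simp
  | succ n ih => rw [pow_succ, ih]; ext <;> simp [add_mul]

theorem mk_fst_zero_pow (b : ZMod p) (n : ℕ) :
    (⟨0, b⟩ : ModularPair p) ^ n = ⟨0, n * b⟩ := by
  induction n with
  | zero => ext <;> simp
  | succ n ih => rw [pow_succ, ih]; ext <;> simp [add_mul]

theorem relations (p : ℕ) [NeZero p] :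
    ∀ w ∈ modularGroupRels p,
      FreeGroup.lift (![⟨1, 0⟩, ⟨0, 1⟩] : Fin 2 → ModularPair p) w = 1 := by
  rintro w (rfl | rfl | rfl)
  · simp only [map_pow, FreeGroup.lift_apply_of, Matrix.cons_val_zero, mk_zero_pow]
    ext <;> simp
  · simp only [map_pow, FreeGroup.lift_apply_of, Matrix.cons_val_one, Matrix.cons_val_zero,
      mk_fst_zero_pow]
    ext <;> simp
  · simp only [map_mul, map_inv, map_pow, FreeGroup.lift_apply_of, Matrix.cons_val_one,
      Matrix.cons_val_zero, mk_zero_pow]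
    rw [mul_inv_eq_one, mul_assoc, mul_assoc, inv_mul_eq_iff_eq_mul, inv_mul_eq_iff_eq_mul]
    ext <;> simp [pMul_one]

/-- The homomorphism from the presented group. -/
def ofPresented (p : ℕ) [NeZero p] : ModularGroupP3 p →* ModularPair p :=
  PresentedGroup.toGroup (relations p)

theorem ofPresented_zero : ofPresented p (PresentedGroup.of 0) = ⟨1, 0⟩ :=
  PresentedGroup.toGroup.of (relations p)

theorem ofPresented_one : ofPresented p (PresentedGroup.of 1) = ⟨0, 1⟩ :=
  PresentedGroup.toGroup.of (relations p)

theorem ofPresented_normalForm (a b : ℕ) :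
    ofPresented p (PresentedGroup.of 1 ^ b * PresentedGroup.of 0 ^ a) = ⟨a, b⟩ := by
  rw [map_mul, map_pow, map_pow, ofPresented_zero, ofPresented_one, mk_zero_pow, mk_fst_zero_pow,
    mk_eq]
  simp

/-- The relation `r s = s r ^ (1 + p)` moves every `s` to the left, and the finite orders of `r` and
`s` turn inverses into positive powers. This gives the injectivity of `ofPresented`. -/
theorem exists_normalForm (w : ModularGroupP3 p) :
    ∃ a b : ℕ, w = PresentedGroup.of 1 ^ b * PresentedGroup.of 0 ^ a := by
  set r : ModularGroupP3 p := PresentedGroup.of 0 with hr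
  set s : ModularGroupP3 p := PresentedGroup.of 1 with hs
  have rel : ∀ w ∈ modularGroupRels p, PresentedGroup.mk (modularGroupRels p) w = 1 := fun w hw =>
    PresentedGroup.one_of_mem hw
  have h1 : r ^ (p ^ 2) = 1 := rel _ (Or.inl rfl)
  have h2 : s ^ p = 1 := rel _ (Or.inr (Or.inl rfl))
  have h3 : r⁻¹ * s⁻¹ * r * s * (r ^ p)⁻¹ = 1 := rel _ (Or.inr (Or.inr rfl))
  have hrs : r * s = s * r ^ (1 + p) := by
    rw [mul_inv_eq_one, mul_assoc, mul_assoc, inv_mul_eq_iff_eq_mul, inv_mul_eq_iff_eq_mul] at h3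
    rw [h3, pow_add, pow_one]
  have hras : ∀ a : ℕ, r ^ a * s = s * r ^ (a * (1 + p)) := by
    intro a
    induction a with
    | zero => simp
    | succ a ih => rw [pow_succ, mul_assoc, hrs, ← mul_assoc, ih, add_mul, one_mul, mul_assoc, ← pow_add]
  have hrasb : ∀ a b : ℕ, r ^ a * s ^ b = s ^ b * r ^ (a * (1 + p) ^ b) := by
    intro a b
    induction b with
    | zero => simp
    | succ b ih => rw [pow_succ, ← mul_assoc, ih, mul_assoc, hras, mul_assoc, mul_assoc, ← pow_succ]
  have hmul : ∀ a b a' b' : ℕ,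
      s ^ b * r ^ a * (s ^ b' * r ^ a') = s ^ (b + b') * r ^ (a * (1 + p) ^ b' + a') := by
    intro a b a' b'
    rw [mul_assoc, ← mul_assoc (r ^ a), hrasb, pow_add, pow_add]
    simp only [mul_assoc]
  have hinv : ∀ (x : ModularGroupP3 p) (n m : ℕ), n ≠ 0 → x ^ n = 1 → (x ^ m)⁻¹ = x ^ ((n - 1) * m) := by
    intro x n m hn hx
    rw [inv_eq_iff_mul_eq_one, ← pow_add]
    have : m + (n - 1) * m = n * m := by
      obtain ⟨k, rfl⟩ := Nat.exists_eq_succ_of_ne_zero hn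
      simp; ring
    rw [this, pow_mul, hx, one_pow]
  have hw : w ∈ Subgroup.closure (Set.range (PresentedGroup.of (rels := modularGroupRels p))) := by
    rw [PresentedGroup.closure_range_of]; trivial
  induction hw using Subgroup.closure_induction with
  | mem x hx =>
    obtain ⟨i, rfl⟩ := hx
    fin_cases i
    · exact ⟨1, 0, by simp [hr]⟩
    · exact ⟨0, 1, by simp [hs]⟩
  | one => exact ⟨0, 0, by simp⟩
  | mul x y _ _ hx hy =>
    obtain ⟨a, b, rfl⟩ := hx
    obtain ⟨a', b', rfl⟩ := hy
    exact ⟨_, _, hmul a b a' b'⟩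
  | inv x _ hx =>
    obtain ⟨a, b, rfl⟩ := hx
    rw [mul_inv_rev, hinv r (p ^ 2) a (NeZero.ne _) h1, hinv s p b (NeZero.ne _) h2, hrasb]
    exact ⟨_, _, rfl⟩

/-- The two forms of the modular group are isomorphic. -/
noncomputable def equivPresented (p : ℕ) [NeZero p] : ModularGroupP3 p ≃* ModularPair p :=
  MulEquiv.ofBijective (ofPresented p) (by
    constructor
    · rw [injective_iff_map_eq_one]
      intro w hw
      obtain ⟨a, b, rfl⟩ := exists_normalForm w
      rw [ofPresented_normalForm] at hw
      have ha := congrArg ModularPair.fst hw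
      have hb := congrArg ModularPair.snd hw
      simp only [fst_one, snd_one, ZMod.natCast_eq_zero_iff] at ha hb
      obtain ⟨a, rfl⟩ := ha
      obtain ⟨b, rfl⟩ := hb
      have h1 : (PresentedGroup.of 0 : ModularGroupP3 p) ^ (p ^ 2) = 1 :=
        PresentedGroup.one_of_mem (Or.inl rfl)
      have h2 : (PresentedGroup.of 1 : ModularGroupP3 p) ^ p = 1 :=
        PresentedGroup.one_of_mem (Or.inr (Or.inl rfl))
      rw [pow_mul, pow_mul, h1, h2, one_pow, one_pow, one_mul]
    · rintro ⟨a, b⟩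
      obtain ⟨m, rfl⟩ := ZMod.natCast_zmod_surjective a
      obtain ⟨n, rfl⟩ := ZMod.natCast_zmod_surjective b
      exact ⟨_, ofPresented_normalForm m n⟩)

/-- The inclusion of the cyclic subgroup of order `p²`. -/
def ofCyclic (p : ℕ) [NeZero p] : Multiplicative (ZMod (p ^ 2)) →* ModularPair p :=
  MonoidHom.mk' (fun a => ⟨a.toAdd, 0⟩) (fun a b => by ext <;> simp)

theorem ofCyclic_injective : Function.Injective (ofCyclic p) := fun _ _ h =>
  congrArg ModularPair.fst h

end ModularPair

/-! ### The descending central sequence and its third term -/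

section DescendingCentral

variable {q : ℕ} {G : Type*} [Group G] [TopologicalSpace G] [IsTopologicalGroup G]

theorem pow_mem_descendingQCentral {i : ℕ} {h : G} (hh : h ∈ descendingQCentral q G (i + 1)) :
    h ^ q ∈ descendingQCentral q G (i + 2) :=
  Subgroup.le_topologicalClosure _ (Subgroup.subset_closure (Or.inl ⟨h, hh, rfl⟩))

theorem commutator_mem_descendingQCentral {i : ℕ} {h : G}
    (hh : h ∈ descendingQCentral q G (i + 1)) (g : G) :
    h⁻¹ * g⁻¹ * h * g ∈ descendingQCentral q G (i + 2) :=
  Subgroup.le_topologicalClosure _ (Subgroup.subset_closure (Or.inr ⟨h, hh, g, rfl⟩))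

theorem descendingQCentral_le {i : ℕ} {H : Subgroup G} (hH : IsClosed (H : Set G))
    (hpow : ∀ h ∈ descendingQCentral q G (i + 1), h ^ q ∈ H)
    (hcomm : ∀ h ∈ descendingQCentral q G (i + 1), ∀ g, h⁻¹ * g⁻¹ * h * g ∈ H) :
    descendingQCentral q G (i + 2) ≤ H := by
  refine Subgroup.topologicalClosure_minimal _ ((Subgroup.closure_le _).2 ?_) hH
  rintro _ (⟨h, hh, rfl⟩ | ⟨h, hh, g, rfl⟩)
  · exact hpow h hh
  · exact hcomm h hh g

theorem isClosed_descendingQCentral (i : ℕ) :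
    IsClosed (descendingQCentral q G (i + 2) : Set G) :=
  Subgroup.isClosed_topologicalClosure _

theorem mem_descendingQCentral_one (g : G) : g ∈ descendingQCentral q G (0 + 1) :=
  Subgroup.mem_top g

theorem descendingQCentral_three_le_two :
    descendingQCentral q G 3 ≤ descendingQCentral q G 2 :=
  descendingQCentral_le (i := 1) (isClosed_descendingQCentral 0) (fun _ hh => pow_mem hh q)
    (fun h _ g => commutator_mem_descendingQCentral (mem_descendingQCentral_one h) g)

instance normal_descendingQCentral_three : (descendingQCentral q G 3).Normal := by
  refine ⟨fun n hn g => ?_⟩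
  -- A conjugate `g n g⁻¹` is `n` times the commutator of `n` and `g⁻¹`.
  have h := mul_mem hn (commutator_mem_descendingQCentral (i := 1)
    (descendingQCentral_three_le_two hn) g⁻¹)
  convert h using 1
  group

/-- The second term maps into the elements `(p t, 0)`, the kernel of `ModularPair p → (ℤ/p)²`; these
are central and killed by `p`. -/
theorem descendingQCentral_three_le_ker {p : ℕ} [NeZero p] (Φ : G →* ModularPair p)
    (hΦ : IsOpen (Φ.ker : Set G)) : descendingQCentral p G 3 ≤ Φ.ker := by
  let π : ModularPair p →* Multiplicative (ZMod p × ZMod p) :=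
    MonoidHom.mk' (fun a => Multiplicative.ofAdd (modP p a.1, a.2)) (fun a b => by
      simp [modP_pMul, ← ofAdd_add])
  have hle : Φ.ker ≤ (π.comp Φ).ker := fun x hx => by
    rw [MonoidHom.mem_ker] at hx ⊢
    rw [MonoidHom.comp_apply, hx, map_one]
  have h2 : descendingQCentral p G 2 ≤ (π.comp Φ).ker := by
    refine descendingQCentral_le (i := 0)
      (Subgroup.isClosed_of_isOpen _ (Subgroup.isOpen_mono hle hΦ)) (fun h _ => ?_) fun h _ g => ?_
    · rw [MonoidHom.mem_ker, map_pow, ← ofAdd_toAdd (π.comp Φ h), ← ofAdd_nsmul]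
      have : p • ((π.comp Φ) h).toAdd = 0 := by ext <;> simp
      rw [this, ofAdd_zero]
    · rw [MonoidHom.mem_ker]
      simp only [map_mul, map_inv]
      rw [mul_right_comm _ _ ((π.comp Φ) h), inv_mul_cancel, one_mul, inv_mul_cancel]
  refine descendingQCentral_le (i := 1) (Subgroup.isClosed_of_isOpen _ hΦ) (fun h hh => ?_)
    fun h hh g => ?_
  all_goals
    have hπ : π (Φ h) = 1 := h2 hh
    have h0 : (modP p (Φ h).1, (Φ h).2) = (0, 0) := congrArg Multiplicative.toAdd hπ
    obtain ⟨h01, h02⟩ := Prod.ext_iff.1 h0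
    obtain ⟨t, ht⟩ := exists_pMul_of_modP_eq_zero p _ h01
    have hh' : Φ h = ⟨pMul p t, 0⟩ := by ext; exacts [ht.symm, h02]
  · rw [MonoidHom.mem_ker, map_pow, hh', ModularPair.mk_zero_pow, mul_pMul]
    ext <;> simp
  · rw [MonoidHom.mem_ker]
    simp only [map_mul, map_inv]
    rw [mul_assoc, mul_assoc, inv_mul_eq_one, eq_inv_mul_iff_mul_eq, hh']
    ext
    · simp [modP_pMul]; ring
    · simp

end DescendingCentral

/-! ### From trivialized cocycles to quotients `ℤ/p²` and `M_{p³}` -/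

namespace ProfiniteCohomology

section

variable {G : Type*} [Group G] [TopologicalSpace G] {p : ℕ}

theorem H1.eval_pow (ψ : H1 G p) (x : G) (n : ℕ) : ψ.eval (x ^ n) = n * ψ.eval x := by
  rw [← nsmul_eq_mul]
  exact map_nsmul ψ n _

theorem H1.exists_eval_eq_one [Fact p.Prime] (ψ : H1 G p) {x : G} (hx : ψ.eval x ≠ 0) :
    ∃ y, ψ.eval y = 1 :=
  ⟨x ^ (ψ.eval x)⁻¹.val, by rw [H1.eval_pow, ZMod.natCast_zmod_val, inv_mul_cancel₀ hx]⟩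

/-- A homomorphism is either a multiple of a nonzero one or nonzero on its kernel. -/
theorem H1.eq_mul_or_exists [Fact p.Prime] (χ η : H1 G p) {x : G} (hx : χ.eval x = 1) :
    (∃ a, ∀ y, η.eval y = a * χ.eval y) ∨ ∃ y, χ.eval y = 0 ∧ η.eval y ≠ 0 := by
  by_contra! h
  obtain ⟨h1, h2⟩ := h
  obtain ⟨y, hy⟩ := h1 (η.eval x)
  have h3 := h2 (y * x ^ (-χ.eval y).val) (by
    rw [H1.eval_mul, H1.eval_pow, ZMod.natCast_zmod_val, hx]; ring)
  rw [H1.eval_mul, H1.eval_pow, ZMod.natCast_zmod_val] at h3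
  exact hy (by linear_combination h3)

/-- The homomorphism to the modular group attached to a trivialization of the cocycle
`β(χ) + χ ∪ η`. -/
def toModularPair [NeZero p] (χ η : H1 G p) (h : C(G, ZMod p))
    (hh : ∀ x y, h y - h (x * y) + h x = χ.eval x * η.eval y + carry p (χ.eval x) (χ.eval y)) :
    G →* ModularPair p :=
  MonoidHom.mk' (fun x => ⟨liftSq (χ.eval x) - pMul p (h x), η.eval x⟩) (fun x y => by
    ext
    · have h1 := congrArg (pMul p) (hh x y)
      simp only [map_sub, map_add, pMul_carry, ← H1.eval_mul] at h1
      simp only [ModularPair.fst_mul, map_sub, modP_liftSq, modP_pMul, sub_zero]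
      linear_combination h1
    · exact H1.eval_mul η x y)

/-- The homomorphism to `ℤ/p²` attached to a trivialization of the cocycle `β(χ)`. -/
def toCyclic [NeZero p] (χ : H1 G p) (h : C(G, ZMod p))
    (hh : ∀ x y, h y - h (x * y) + h x = carry p (χ.eval x) (χ.eval y)) :
    G →* Multiplicative (ZMod (p ^ 2)) :=
  MonoidHom.mk' (fun x => .ofAdd (liftSq (χ.eval x) - pMul p (h x))) (fun x y => by
    rw [← ofAdd_add]
    congr 1
    have h1 := congrArg (pMul p) (hh x y)
    simp only [map_sub, map_add, pMul_carry, ← H1.eval_mul] at h1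
    linear_combination h1)

theorem eq_zero_of_liftSq_sub_pMul_eq_zero [NeZero p] {a b : ZMod p}
    (h : liftSq a - pMul p b = 0) : a = 0 ∧ b = 0 := by
  have ha : a = 0 := by
    have := congrArg (modP p) h
    simpa [modP_liftSq, modP_pMul] using this
  subst ha
  refine ⟨rfl, pMul_injective p ?_⟩
  simpa [liftSq, neg_eq_zero] using h

/-- Such a `u = 1 + p t` is a unit with inverse `1 - p t`, because `(p t)² = 0`. Thus powers of an
element with `χ = 1` reach every value in `ℤ/p²`. -/
theorem exists_natCast_mul_eq [NeZero p] {u : ZMod (p ^ 2)} (hu : modP p u = 1)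
    (a : ZMod (p ^ 2)) : ∃ n : ℕ, (n : ZMod (p ^ 2)) * u = a := by
  obtain ⟨t, ht⟩ := exists_pMul_of_modP_eq_zero p (u - 1) (by simp [hu])
  have h1 : pMul p t * pMul p t = 0 := by rw [mul_pMul, modP_pMul, zero_mul, map_zero]
  refine ⟨(a * (1 - pMul p t)).val, ?_⟩
  rw [ZMod.natCast_zmod_val, eq_add_of_sub_eq ht.symm]
  linear_combination -a * h1

/-- A trivialization of `β(χ) + χ ∪ η` with `χ ≠ 0` gives a quotient that is cyclic of order `p²` or
modular of order `p³`. -/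
theorem exists_normal_of_coboundary [Fact p.Prime] (hp : p ≠ 2) (χ η : H1 G p) (h : C(G, ZMod p))
    (hh : ∀ x y, h y - h (x * y) + h x = χ.eval x * η.eval y + carry p (χ.eval x) (χ.eval y))
    {x₀ : G} (hx₀ : χ.eval x₀ ≠ 0) :
    ∃ N : Subgroup G, (∃ _ : N.Normal, IsOpen (N : Set G) ∧
        (Nonempty (G ⧸ N ≃* Unit) ∨
          Nonempty (G ⧸ N ≃* Multiplicative (ZMod (p ^ 2))) ∨
          Nonempty (G ⧸ N ≃* ModularGroupP3 p))) ∧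
      ∀ x ∈ N, χ.eval x = 0 ∧ h x = 0 := by
  obtain ⟨x₁, hx₁⟩ := χ.exists_eval_eq_one hx₀
  rcases χ.eq_mul_or_exists η hx₁ with ⟨a, ha⟩ | ⟨y, hy, hy'⟩
  · have h2 : (2 : ZMod p) ≠ 0 := by
      intro h
      have := (ZMod.natCast_eq_zero_iff 2 p).1 (by exact_mod_cast h)
      exact hp ((Nat.prime_dvd_prime_iff_eq Fact.out Nat.prime_two).1 this)
    -- The coboundary of `χ² / 2` is `-χ ∪ χ`, so this correction removes `χ ∪ η = a (χ ∪ χ)` and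
    -- leaves a trivialization of `β(χ)` alone.
    let k : C(G, ZMod p) := ⟨fun x => h x + a * χ.eval x ^ 2 / 2,
      h.continuous.add ((continuous_of_discreteTopology
        (f := fun t : ZMod p => a * t ^ 2 / 2)).comp χ.continuous_eval)⟩
    have hk : ∀ x, k x = h x + a * χ.eval x ^ 2 / 2 := fun _ => rfl
    let Φ := toCyclic χ k (fun x y => by
      have h1 := hh x y
      rw [ha] at h1
      simp only [hk, H1.eval_mul]
      field_simp
      linear_combination 2 * h1)
    have hΦ : ∀ x, Φ x = .ofAdd (liftSq (χ.eval x) - pMul p (k x)) := fun _ => rfl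
    refine ⟨Φ.ker, ⟨inferInstance, ?_, Or.inr (Or.inl ⟨QuotientGroup.quotientKerEquivOfSurjective Φ
      fun b => ?_⟩)⟩, fun x hx => ?_⟩
    · exact (isOpen_discrete {t : ZMod p × ZMod p |
        Multiplicative.ofAdd (liftSq t.1 - pMul p t.2) = 1}).preimage
        (χ.continuous_eval.prodMk k.continuous)
    · obtain ⟨n, hn⟩ := exists_natCast_mul_eq (u := liftSq (χ.eval x₁) - pMul p (k x₁))
        (by simp [modP_liftSq, modP_pMul, hx₁]) b.toAdd
      exact ⟨x₁ ^ n, by rw [map_pow, hΦ, ← ofAdd_nsmul, nsmul_eq_mul, hn, ofAdd_toAdd]⟩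
    · obtain ⟨h1, h2⟩ := eq_zero_of_liftSq_sub_pMul_eq_zero (ofAdd_eq_one.1 ((hΦ x).symm.trans hx))
      rw [hk, h1] at h2
      exact ⟨h1, by simpa using h2⟩
  · let Φ := toModularPair χ η h hh
    have hΦ : ∀ x, Φ x = ⟨liftSq (χ.eval x) - pMul p (h x), η.eval x⟩ := fun _ => rfl
    -- an element with `χ = 1` and `η = 0`
    obtain ⟨x₂, hx₂, hx₂'⟩ : ∃ x, χ.eval x = 1 ∧ η.eval x = 0 := by
      refine ⟨x₁ * y ^ (-η.eval x₁ / η.eval y).val, ?_, ?_⟩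
      · rw [H1.eval_mul, H1.eval_pow, hy, hx₁]; ring
      · rw [H1.eval_mul, H1.eval_pow, ZMod.natCast_zmod_val]; field_simp; ring
    have hsurj : Function.Surjective Φ := by
      rintro ⟨a, b⟩
      set z := y ^ (b / η.eval y).val with hz
      obtain ⟨n, hn⟩ := exists_natCast_mul_eq (u := liftSq (χ.eval x₂) - pMul p (h x₂))
        (by simp [modP_liftSq, modP_pMul, hx₂]) (a - (Φ z).1)
      refine ⟨z * x₂ ^ n, ?_⟩
      rw [map_mul, map_pow Φ x₂ n, hΦ x₂, hx₂', ModularPair.mk_zero_pow, hn]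
      ext
      · simp
      · rw [ModularPair.snd_mul, add_zero]
        change η.eval z = b
        rw [hz, H1.eval_pow, ZMod.natCast_zmod_val, div_mul_cancel₀ _ hy']
    refine ⟨Φ.ker, ⟨inferInstance, ?_, Or.inr (Or.inr
      ⟨(QuotientGroup.quotientKerEquivOfSurjective Φ hsurj).trans
        (ModularPair.equivPresented p).symm⟩)⟩, fun x hx => ?_⟩
    · exact (isOpen_discrete {t : ZMod p × ZMod p × ZMod p |
        (⟨liftSq t.1 - pMul p t.2.1, t.2.2⟩ : ModularPair p) = 1}).preimage
        (χ.continuous_eval.prodMk (h.continuous.prodMk η.continuous_eval))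
    · exact eq_zero_of_liftSq_sub_pMul_eq_zero
        (congrArg ModularPair.fst ((hΦ x).symm.trans hx))

end

end ProfiniteCohomology

/-! ### Detecting elements outside `G⁽³⁾` by cochains -/

namespace ProfiniteCohomology

section

variable {G : Type*} [Group G] [TopologicalSpace G] {p : ℕ}

/-- The value of an element of `H¹ ⊗ H¹` as a biadditive function. -/
noncomputable def evalTensor (x y : G) : H1 G p ⊗[ℤ] H1 G p →ₗ[ℤ] ZMod p :=
  TensorProduct.lift (AddMonoidHom.mk' (fun ψ => (AddMonoidHom.mk'
      (fun ψ' => ψ.eval x * ψ'.eval y) (fun a b => mul_add _ (a.eval y) (b.eval y))).toIntLinearMap)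
    (fun a b => by ext c; exact add_mul (a.eval x) (b.eval x) _)).toIntLinearMap

theorem evalTensor_tmul (x y : G) (ψ ψ' : H1 G p) :
    evalTensor x y (ψ ⊗ₜ[ℤ] ψ') = ψ.eval x * ψ'.eval y := rfl

/-- A cochain with zero coboundary is itself a member of `H¹(G)`. Consequently two trivializations
of the same cocycle agree at any `g` killed by `H¹(G)`. -/
theorem eq_zero_of_coboundary_eq_zero {h : C(G, ZMod p)} (hh : ∀ x y, h y - h (x * y) + h x = 0)
    {g : G} (hg : ∀ χ : H1 G p, χ.eval g = 0) : h g = 0 :=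
  hg
    { toAddMonoidHom := AddMonoidHom.mk' (fun x : Additive G => h x.toMul) fun x y => by
        rw [toMul_add]; linear_combination -hh x.toMul y.toMul
      continuous_toFun := h.continuous.comp continuous_toMul }

variable [IsTopologicalGroup G]

theorem H2.mk_eq_zero_iff {A : Type*} [AddCommGroup A] [TopologicalSpace A]
    [IsTopologicalAddGroup A] (z : Z2 G A) :
    H2.mk G A z = 0 ↔ ∃ h : C(G, A), ∀ x y, h y - h (x * y) + h x = z.1 (x, y) := by
  refine (QuotientAddGroup.eq_zero_iff z).trans ?_
  rw [AddSubgroup.mem_addSubgroupOf]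
  constructor
  · rintro ⟨h, hh⟩
    exact ⟨h, fun x y => DFunLike.congr_fun hh (x, y)⟩
  · rintro ⟨h, hh⟩
    exact ⟨h, ContinuousMap.ext fun x => hh x.1 x.2⟩

/-- An explicit representative turns equations in `H2` into equations between functions, so that
values of trivializations at one point can be followed. -/
theorem exists_cocycle_cupTensor (t : H1 G p ⊗[ℤ] H1 G p) :
    ∃ z : Z2 G (ZMod p), H2.mk G (ZMod p) z = cupTensor t ∧
      ∀ x y, z.1 (x, y) = evalTensor x y t := by
  induction t with
  | zero => exact ⟨0, by simp, fun x y => by simp⟩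
  | tmul ψ ψ' => exact ⟨cupCocycle ψ ψ', rfl, fun x y => rfl⟩
  | add s t hs ht =>
    obtain ⟨z, hz, hz'⟩ := hs
    obtain ⟨w, hw, hw'⟩ := ht
    refine ⟨z + w, by rw [map_add, hz, hw, map_add], fun x y => ?_⟩
    rw [map_add, ← hz', ← hw']
    rfl

theorem cupTensor_eq_zero_iff (t : H1 G p ⊗[ℤ] H1 G p) :
    cupTensor t = 0 ↔
      ∃ h : C(G, ZMod p), ∀ x y, h y - h (x * y) + h x = evalTensor x y t := by
  obtain ⟨z, hz, hz'⟩ := exists_cocycle_cupTensor t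
  rw [← hz, H2.mk_eq_zero_iff]
  simp only [hz']

theorem cupTensor_add_bockstein_eq_zero_iff [NeZero p] (t : H1 G p ⊗[ℤ] H1 G p) (ψ : H1 G p) :
    cupTensor t + bockstein ψ = 0 ↔ ∃ h : C(G, ZMod p), ∀ x y,
      h y - h (x * y) + h x = evalTensor x y t + carry p (ψ.eval x) (ψ.eval y) := by
  obtain ⟨z, hz, hz'⟩ := exists_cocycle_cupTensor t
  rw [← hz, bockstein, ← map_add, H2.mk_eq_zero_iff]
  simp only [← hz']
  rfl

/-- The element of `H¹(G)` inflated from a character of a discrete quotient. -/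
def inflate {N : Subgroup G} [N.Normal] (hN : IsOpen (N : Set G)) (χ : Additive (G ⧸ N) →+ ZMod p) :
    H1 G p where
  toAddMonoidHom := χ.comp (QuotientGroup.mk' N).toAdditive
  continuous_toFun :=
    have := QuotientGroup.discreteTopology hN
    (continuous_of_discreteTopology (f := fun x : G ⧸ N => χ (.ofMul x))).comp
      (QuotientGroup.continuous_mk.comp continuous_toMul)

/-- In a profinite group, an element outside of `G⁽³⁾` that is killed by `H¹(G)` is detected by a
trivialization of a sum of cup products and a Bockstein element. -/
theorem exists_coboundary_of_notMem [CompactSpace G] [TotallyDisconnectedSpace G] [Fact p.Prime]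
    (hp : p ≠ 2) {g : G} (hg : g ∉ descendingQCentral p G 3) (hg' : ∀ χ : H1 G p, χ.eval g = 0) :
    ∃ (h : C(G, ZMod p)) (t : H1 G p ⊗[ℤ] H1 G p) (ψ : H1 G p), h g ≠ 0 ∧
      ∀ x y, h y - h (x * y) + h x = evalTensor x y t + carry p (ψ.eval x) (ψ.eval y) := by
  classical
  -- Since `G⁽³⁾` is closed, a small enough open normal `U` keeps `g` outside `G⁽³⁾ U`.
  obtain ⟨U, hU⟩ := ProfiniteGrp.exist_openNormalSubgroup_sub_open_nhds_of_one
    (U := {u : G | g * u⁻¹ ∉ descendingQCentral p G 3})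
    ((isClosed_descendingQCentral 1).isOpen_compl.preimage (by fun_prop)) (by simpa using hg)
  let N : Subgroup G := descendingQCentral p G 3 ⊔ U.toSubgroup
  have hUn : U.toSubgroup.Normal := U.isNormal'
  have hNn : N.Normal := Subgroup.sup_normal _ _
  have hN : IsOpen (N : Set G) := Subgroup.isOpen_mono le_sup_right U.isOpen'
  have hgN : g ∉ N := by
    intro h
    obtain ⟨y, hy, z, hz, rfl⟩ := Subgroup.mem_sup_of_normal_right.1 h
    exact hU hz (by simpa using hy)
  have h3 : ∀ x ∈ descendingQCentral p G 3, (x : G ⧸ N) = 1 := fun x hx =>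
    (QuotientGroup.eq_one_iff x).2 (le_sup_left (a := descendingQCentral p G 3) hx)
  have : Finite (G ⧸ N) := Subgroup.quotient_finite_of_isOpen N hN
  have := QuotientGroup.discreteTopology hN
  -- All central elements of exponent dividing `p`. The image of `G⁽²⁾` lies here because `G⁽³⁾`
  -- dies in the quotient.
  let Z : Subgroup (G ⧸ N) :=
    { carrier := {z | (∀ x, z * x = x * z) ∧ z ^ p = 1}
      one_mem' := ⟨fun x => by simp, one_pow p⟩
      mul_mem' := by
        rintro a b ⟨ha, ha'⟩ ⟨hb, hb'⟩
        refine ⟨fun x => by rw [mul_assoc, hb, ← mul_assoc, ha, mul_assoc], ?_⟩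
        rw [(show Commute a b from ha b).mul_pow, ha', hb', one_mul]
      inv_mem' := by
        rintro a ⟨ha, ha'⟩
        exact ⟨fun x => ((show Commute a x from ha x).inv_left).eq, by rw [inv_pow, ha', inv_one]⟩ }
  have hZ : ∀ z ∈ Z, ∀ x, z * x = x * z := fun z hz => hz.1
  have h2 : ∀ x ∈ descendingQCentral p G 2, (x : G ⧸ N) ∈ Z := by
    intro x hx
    refine ⟨fun y => ?_, ?_⟩
    · obtain ⟨y, rfl⟩ := QuotientGroup.mk_surjective y
      have h := h3 _ (commutator_mem_descendingQCentral (i := 1) hx y)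
      rw [mul_assoc, mul_assoc] at h
      simpa only [QuotientGroup.mk_mul, QuotientGroup.mk_inv, inv_mul_eq_one,
        eq_inv_mul_iff_mul_eq, inv_mul_eq_iff_eq_mul, mul_one, eq_comm] using h
    · exact h3 _ (pow_mem_descendingQCentral (i := 1) hx)
  have hpow : ∀ x : G ⧸ N, x ^ p ∈ Z := by
    intro x
    obtain ⟨x, rfl⟩ := QuotientGroup.mk_surjective x
    exact h2 _ (pow_mem_descendingQCentral (mem_descendingQCentral_one x))
  have hcomm : ∀ x y : G ⧸ N, x * y * x⁻¹ * y⁻¹ ∈ Z := by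
    intro x y
    obtain ⟨x, rfl⟩ := QuotientGroup.mk_surjective x
    obtain ⟨y, rfl⟩ := QuotientGroup.mk_surjective y
    simpa using h2 _ (commutator_mem_descendingQCentral (mem_descendingQCentral_one x⁻¹) y⁻¹)
  -- The quotient by `Z` is elementary abelian, so a `g` outside `Z` would be seen by a character of
  -- `G`.
  have hgZ : (g : G ⧸ N) ∈ Z := by
    by_contra h
    have : Z.Normal := ⟨fun z hz x => by rwa [← hZ z hz, mul_inv_cancel_right]⟩
    obtain ⟨χ, -, hχ⟩ := exists_character_ne_zero p Z hpow
      (fun a b => ⟨_, hcomm a b, by group⟩) _ h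
    exact hχ (hg' (inflate hN χ))
  obtain ⟨F, -, hF⟩ := exists_character_ne_zero p (⊥ : Subgroup Z)
    (fun a => by rw [Subgroup.mem_bot]; exact Subtype.ext a.2.2)
    (fun a b => ⟨1, one_mem _, by rw [one_mul]; exact Subtype.ext (hZ _ a.2 _)⟩)
    ⟨(g : G ⧸ N), hgZ⟩ (fun h => hgN ((QuotientGroup.eq_one_iff g).1
      (congrArg Subtype.val (Subgroup.mem_bot.1 h))))
  let L : G ⧸ N → ZMod p := fun x => if h : x ∈ Z then F (.ofMul ⟨x, h⟩) else 0
  have hL : ∀ z (hz : z ∈ Z), L z = F (.ofMul ⟨z, hz⟩) := fun z hz => dif_pos hz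
  obtain ⟨f, P, n, ψ, ψ', hf, hf'⟩ := exists_coboundary_eq_sum_mul_add_carry (Z := Z) (L := L) hp hZ
    hcomm hpow (fun z hz w hw => by
      rw [hL z hz, hL w hw, hL _ (mul_mem hz hw), ← map_add, ← ofMul_mul]; rfl)
    (fun z hz => hz.2)
  refine ⟨⟨fun x => f x, continuous_of_discreteTopology.comp QuotientGroup.continuous_mk⟩,
    ∑ i, inflate hN (ψ i) ⊗ₜ[ℤ] inflate hN (ψ' i), inflate hN P, ?_, fun x y => ?_⟩
  · change f g ≠ 0
    rwa [hf _ hgZ, hL _ hgZ, neg_ne_zero]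
  · rw [map_sum]
    exact hf' x y

/-- An element of a profinite group of Galois relation type that is trivial in all discrete quotients
isomorphic to `1`, `ℤ/p²` or the modular group lies in `G⁽³⁾`. -/
theorem mem_descendingQCentral_three [CompactSpace G] [TotallyDisconnectedSpace G] [Fact p.Prime]
    (hp : p ≠ 2) (hG : HasGaloisRelationType p G) {g : G}
    (hg : ∀ N : Subgroup G, (∃ _ : N.Normal, IsOpen (N : Set G) ∧
        (Nonempty (G ⧸ N ≃* Unit) ∨
          Nonempty (G ⧸ N ≃* Multiplicative (ZMod (p ^ 2))) ∨
          Nonempty (G ⧸ N ≃* ModularGroupP3 p))) → g ∈ N) :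
    g ∈ descendingQCentral p G 3 := by
  obtain ⟨ξ, hξ⟩ := hG.bockstein_eq_cup
  have hξ' : ∀ ψ : H1 G p, ∃ h : C(G, ZMod p), ∀ x y, h y - h (x * y) + h x =
      ψ.eval x * ξ.eval y + carry p (ψ.eval x) (ψ.eval y) := fun ψ =>
    (cupTensor_add_bockstein_eq_zero_iff (ψ ⊗ₜ[ℤ] ξ) ψ).1 (hξ ψ)
  have hχ : ∀ χ : H1 G p, χ.eval g = 0 := by
    intro χ
    by_contra hne
    obtain ⟨h, hh⟩ := hξ' χ
    obtain ⟨N, hN, hN'⟩ := exists_normal_of_coboundary hp χ ξ h hh hne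
    exact hne (hN' g (hg N hN)).1
  have key : ∀ (χ η : H1 G p) (h : C(G, ZMod p)), (∀ x y, h y - h (x * y) + h x =
      χ.eval x * η.eval y + carry p (χ.eval x) (χ.eval y)) → h g = 0 := by
    intro χ η h hh
    -- For `χ = 0` no quotient is produced, but then `h` is a homomorphism and `hχ` applies.
    by_cases h0 : ∀ x, χ.eval x = 0
    · exact eq_zero_of_coboundary_eq_zero (fun x y => by rw [hh, h0, zero_mul, carry_zero_left,
        add_zero]) hχ
    · push Not at h0
      obtain ⟨x, hx⟩ := h0
      obtain ⟨N, hN, hN'⟩ := exists_normal_of_coboundary hp χ η h hh hx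
      exact (hN' g (hg N hN)).2
  have hker : ∀ t : H1 G p ⊗[ℤ] H1 G p, cupTensor t = 0 →
      ∃ h : C(G, ZMod p), (∀ x y, h y - h (x * y) + h x = evalTensor x y t) ∧ h g = 0 := by
    intro t ht
    have ht' : t ∈ AddSubgroup.closure {t | cupTensor t = 0 ∧ ∃ ψ ψ' : H1 G p, t = ψ ⊗ₜ[ℤ] ψ'} := by
      rw [← hG.ker_cup]; exact ht
    clear ht
    induction ht' using AddSubgroup.closure_induction with
    | mem t ht =>
      obtain ⟨ht, ψ, ψ', rfl⟩ := ht
      obtain ⟨h, hh⟩ := (cupTensor_eq_zero_iff _).1 ht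
      obtain ⟨k, hk⟩ := hξ' ψ
      refine ⟨h, hh, ?_⟩
      -- Adding the trivialization for `(ψ, ξ)` supplies the Bockstein term needed for a map to
      -- `M_{p³}`, now over `(ψ, ψ' + ξ)`.
      have h1 : (h + k) g = 0 := key ψ (ψ' + ξ) (h + k) fun x y => by
        have e1 := hh x y
        rw [evalTensor_tmul] at e1
        have e2 : (ψ' + ξ).eval y = ψ'.eval y + ξ.eval y := rfl
        simp only [ContinuousMap.add_apply, e2]
        linear_combination e1 + hk x y
      simpa [key ψ ξ k hk] using h1
    | zero => exact ⟨0, fun x y => by simp, rfl⟩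
    | add s t _ _ hs ht =>
      obtain ⟨h, hh, hh0⟩ := hs
      obtain ⟨k, hk, hk0⟩ := ht
      refine ⟨h + k, fun x y => ?_, by simp [hh0, hk0]⟩
      rw [map_add, ← hh, ← hk]
      simp only [ContinuousMap.add_apply]
      ring
    | neg t _ ht =>
      obtain ⟨h, hh, hh0⟩ := ht
      refine ⟨-h, fun x y => ?_, by simp [hh0]⟩
      rw [map_neg, ← hh]
      simp only [ContinuousMap.neg_apply]
      ring
  by_contra hg3
  obtain ⟨f, t, ψ, hfg, hf⟩ := exists_coboundary_of_notMem hp hg3 hχ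
  obtain ⟨k, hk⟩ := hξ' ψ
  -- The Bockstein terms of `f` and `k` cancel, so `f - k` shows that `t - ψ ⊗ ξ` has trivial cup
  -- product.
  obtain ⟨h, hh, hh0⟩ := hker (t - ψ ⊗ₜ[ℤ] ξ) ((cupTensor_eq_zero_iff _).2 ⟨f - k, fun x y => by
    rw [map_sub, evalTensor_tmul]
    simp only [ContinuousMap.sub_apply]
    linear_combination hf x y - hk x y⟩)
  -- Both `f - k` and `h` trivialize the same cocycle, so they differ by a homomorphism.
  have h1 : (f - k - h) g = 0 := eq_zero_of_coboundary_eq_zero (fun x y => by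
    have e := hh x y
    rw [map_sub, evalTensor_tmul] at e
    simp only [ContinuousMap.sub_apply]
    linear_combination hf x y - hk x y - e) hχ
  simp only [ContinuousMap.sub_apply, key ψ ξ k hk, hh0, sub_zero] at h1
  exact hfg h1

end

end ProfiniteCohomology

/-! ### The two inclusions -/

theorem descendingQCentral_three_le_of_injective {G : Type*} [Group G] [TopologicalSpace G]
    [IsTopologicalGroup G] {p : ℕ} [NeZero p] {N : Subgroup G} [N.Normal]
    (hN : IsOpen (N : Set G)) (ι : G ⧸ N →* ModularPair p) (hι : Function.Injective ι) :
    descendingQCentral p G 3 ≤ N := by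
  have h : (ι.comp (QuotientGroup.mk' N)).ker = N := by
    rw [MonoidHom.ker_comp_of_injective _ _ hι, QuotientGroup.ker_mk']
  have h' := descendingQCentral_three_le_ker (ι.comp (QuotientGroup.mk' N)) (by rwa [h])
  rwa [h] at h'

theorem corollary11p2 (p : ℕ) [Fact p.Prime] (hp : p ≠ 2)
    (G : Type*) [Group G] [TopologicalSpace G] [IsTopologicalGroup G]
    [CompactSpace G] [TotallyDisconnectedSpace G]
    (hG : ProfiniteCohomology.HasGaloisRelationType p G) :
    descendingQCentral p G 3 =
      sInf {N : Subgroup G | ∃ _ : N.Normal, IsOpen (N : Set G) ∧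
        (Nonempty (G ⧸ N ≃* Unit) ∨
          Nonempty (G ⧸ N ≃* Multiplicative (ZMod (p ^ 2))) ∨
          Nonempty (G ⧸ N ≃* ModularGroupP3 p))} := by
  refine le_antisymm (le_sInf ?_) fun g hg =>
    ProfiniteCohomology.mem_descendingQCentral_three hp hG fun N hN => Subgroup.mem_sInf.1 hg N hN
  rintro N ⟨hNn, hN, ⟨⟨e⟩⟩ | ⟨⟨e⟩⟩ | ⟨⟨e⟩⟩⟩
  -- The trivial homomorphism is injective because the quotient has one element.
  · exact descendingQCentral_three_le_of_injective hN 1 fun a b _ => e.injective rfl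
  · exact descendingQCentral_three_le_of_injective hN ((ModularPair.ofCyclic p).comp e.toMonoidHom)
      (ModularPair.ofCyclic_injective.comp e.injective)
  · exact descendingQCentral_three_le_of_injective hN
      ((ModularPair.equivPresented p).toMonoidHom.comp e.toMonoidHom)
      ((ModularPair.equivPresented p).injective.comp e.injective)
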